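/- **Setting.** An instance of unweighted, complete correlation clustering is a complete graph $G=(V,E)$ on a finite vertex set $V$ whose edges are partitioned into positive edges $E^+$ and negative edges $E^-$. Let $N_u^+$ be the set consisting of $u$ (every vertex has a positive self-loop) and of all $v$ with $uv\in E^+$, and let $N_u^-=V\setminus N_u^+$. A clustering $\mathcal C$ is a partition of $V$. A positive edge is a disagreement if its ends lie in different clusters, a negative edge if its ends lie in the same cluster; $y_{\mathcal C}(u)$ is the number of disagreements incident to $u$. The $\ell_p$-cost of $\mathcal C$ is $\|y_{\mathcal C}\|_p$, and $\mathsf{OPT}_p=\min_{\mathcal C}\|y_{\mathcal C}\|_p$. The correlation metric is $d_{uv}=1-\frac{|N_u^+\cap N_v^+|}{|N_u^+\cup N_v^+|}$. For a semi-metric $x$ on $V$ (symmetric, zero on the diagonal, satisfying the triangle inequality) with values in $[0,1]$, the fractional cost of $x$ in the $\ell_p$-norm objective is $\|y\|_p$, where $y_u=\sum_{v\in N_u^+}x_{uv}+\sum_{v\in N_u^-}(1-x_{uv})$. The bad-triangle LP is $\min\{\sum_{e\in E}x_e : x\ge 0,\ x_{ij}+x_{jk}+x_{ki}\ge 1 \text{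 for all } ijk\in\mathcal T\}$, where $\mathcal T$ is the set of triangles with exactly two positive edges and one negative edge; $\mathsf{OPT}_P$ is its optimal value. The KMZ (Kalhan–Makarychev–Zhou) rounding algorithm, on input a semi-metric $z$ on $V$, puts $r=1/5$, $S=V$, and while $S\ne\emptyset$ picks a vertex $u\in S$ maximizing $\sum_{v\in S,\ z_{uv}\le r}(r-z_{uv})$ over $S$ (ties broken arbitrarily), outputs the cluster $\{v\in S: z_{uv}\le 2r\}$, and removes it from $S$. **Theorem.** Suppose that the subgraph $(V,E^+)$ of positive edges is regular. Then $d$ is a semi-metric with values in $[0,1]$, and its fractional cost in the $\ell_1$-norm objective satisfies $$\sum_{u\in V}\sum_{v\in N_u^+}d_{uv}+\sum_{u\in V}\sum_{v\in N_u^-}(1-d_{uv})\le 6\cdot\mathsf{OPT}_1 ,$$ and even $\le 6\cdot(2\,\mathsf{OPT}_P)$ (the factor $2$ appears because the left side and $\mathsf{OPT}_1$ count every edge at both of its ends, $\mathsf{OPT}_P$ only once). Moreover, there is a universal constant $K$ such that, for every such instance, the KMZ rounding algorithm on input $d$ produces a clustering, and every clustering $\mathcal C$ that it can produce satisfies both $\|y_{\mathcal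 C}\|_1\le K\cdot\mathsf{OPT}_1$ and $\|y_{\mathcal C}\|_\infty\le K\cdot\mathsf{OPT}_\infty$. -/

import Mathlib

open scoped ENNReal

noncomputable section

namespace CorrelationClustering

/-!
An instance of unweighted, complete correlation clustering on a finite vertex set `V` is given by
the simple graph `G` of its positive edges; every other pair of distinct vertices is a negative
edge. Every vertex carries, in addition, a positive self-loop.
-/

/-- The positive neighbourhood of `u`; it contains `u` because of the positive self-loop. -/
def posNbr {V : Type*} [Fintype V] [DecidableEq V] (G : SimpleGraph V) [DecidableRel G.Adj]
    (u : V) : Finset V :=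
  Finset.univ.filter fun v => v = u ∨ G.Adj u v

/-- The negative neighbourhood of `u`. -/
def negNbr {V : Type*} [Fintype V] [DecidableEq V] (G : SimpleGraph V) [DecidableRel G.Adj]
    (u : V) : Finset V :=
  Finset.univ.filter fun v => v ≠ u ∧ ¬ G.Adj u v

/-- The correlation metric. -/
def corrMetric {V : Type*} [Fintype V] [DecidableEq V] (G : SimpleGraph V) [DecidableRel G.Adj]
    (u v : V) : ℝ :=
  1 - ((posNbr G u ∩ posNbr G v).card : ℝ) / ((posNbr G u ∪ posNbr G v).card : ℝ)

/-- The `ℓ_p`-norm of a vector indexed by the vertices. -/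
def vecNorm {V : Type*} [Fintype V] (p : ℝ≥0∞) (y : V → ℝ) : ℝ :=
  ‖WithLp.toLp p y‖

/-- Clusterings are partitions of the vertex set. -/
abbrev Clustering (V : Type*) [Fintype V] [DecidableEq V] : Type _ :=
  Finpartition (Finset.univ : Finset V)

/-- The disagreement vector: positive edges leaving the cluster of `u`, and negative edges
from `u` that stay inside it. -/
def disagreements {V : Type*} [Fintype V] [DecidableEq V] (G : SimpleGraph V)
    [DecidableRel G.Adj] (C : Clustering V) (u : V) : ℕ :=
  ((posNbr G u).filter fun v => v ∉ C.part u).card +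
    ((negNbr G u).filter fun v => v ∈ C.part u).card

/-- The objective value of a clustering for the `ℓ_p`-norm. -/
def cost {V : Type*} [Fintype V] [DecidableEq V] (G : SimpleGraph V) [DecidableRel G.Adj]
    (p : ℝ≥0∞) (C : Clustering V) : ℝ :=
  vecNorm p fun u => (disagreements G C u : ℝ)

/-- The optimal objective value for the `ℓ_p`-norm, a minimum over finitely many clusterings. -/
def opt {V : Type*} [Fintype V] [DecidableEq V] (G : SimpleGraph V) [DecidableRel G.Adj]
    (p : ℝ≥0∞) : ℝ :=
  ⨅ C : Clustering V, cost G p C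

/-- Feasible solutions of the metric relaxation: semi-metrics with values in `[0, 1]`. -/
structure IsFeasible {V : Type*} (x : V → V → ℝ) : Prop where
  self : ∀ u, x u u = 0
  symm : ∀ u v, x u v = x v u
  triangle : ∀ u v w, x u v ≤ x u w + x v w
  nonneg : ∀ u v, 0 ≤ x u v
  le_one : ∀ u v, x u v ≤ 1

/-- The fractional disagreement `y_u` determined by `x` in the metric relaxation. -/
def fracDisagreement {V : Type*} [Fintype V] [DecidableEq V] (G : SimpleGraph V)
    [DecidableRel G.Adj] (x : V → V → ℝ) (u : V) : ℝ :=
  ∑ v ∈ posNbr G u, x u v + ∑ v ∈ negNbr G u, (1 - x u v)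

/-- The fractional cost of `x` in the `ℓ_p`-norm objective. -/
def fracCost {V : Type*} [Fintype V] [DecidableEq V] (G : SimpleGraph V) [DecidableRel G.Adj]
    (p : ℝ≥0∞) (x : V → V → ℝ) : ℝ :=
  vecNorm p (fracDisagreement G x)

/-- Feasibility in the bad-triangle relaxation. A bad triangle has the two positive edges `ij`, `jk`
and the negative edge `ki`. -/
structure IsBadTriangleFeasible {V : Type*} (G : SimpleGraph V) (x : Sym2 V → ℝ) : Prop where
  nonneg : ∀ e, 0 ≤ x e
  cover : ∀ i j k, G.Adj i j → G.Adj j k → k ≠ i → ¬ G.Adj k i →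
    1 ≤ x s(i, j) + x s(j, k) + x s(k, i)

/-- The optimal value of the bad-triangle relaxation; the objective sums over all (unordered)
edges of the complete graph. -/
def badTriangleOpt {V : Type*} [Fintype V] [DecidableEq V] (G : SimpleGraph V) : ℝ :=
  sInf ((fun x : Sym2 V → ℝ => ∑ e ∈ (⊤ : SimpleGraph V).edgeFinset, x e) ''
    {x | IsBadTriangleFeasible G x})

/-- The ball of radius `ρ` around `u`, intersected with the set `S` of unclustered vertices. -/
def ballIn {V : Type*} (z : V → V → ℝ) (S : Finset V) (u : V) (ρ : ℝ) : Finset V :=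
  S.filter fun v => z u v ≤ ρ

/-- The quantity that a cluster centre maximizes, for the radius parameter `r`. -/
def centerScore {V : Type*} (z : V → V → ℝ) (r : ℝ) (S : Finset V) (u : V) : ℝ :=
  ∑ v ∈ ballIn z S u r, (r - z u v)

/-- `RoundingRun z r S L`: started on the unclustered set `S`, the rounding loop with parameter `r`
can produce the list `L` of clusters. Ties between maximizers may be broken arbitrarily. -/
inductive RoundingRun {V : Type*} [DecidableEq V] (z : V → V → ℝ) (r : ℝ) :
    Finset V → List (Finset V) → Prop
  | done : RoundingRun z r ∅ []
  | step (S : Finset V) (u : V) (L : List (Finset V)) (hu : u ∈ S)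
      (hmax : ∀ w ∈ S, centerScore z r S w ≤ centerScore z r S u)
      (hrun : RoundingRun z r (S \ ballIn z S u (2 * r)) L) :
      RoundingRun z r S (ballIn z S u (2 * r) :: L)

/-- `C` is a possible output of the Kalhan–Makarychev–Zhou rounding algorithm (`r = 1/5`)
on input `z`. -/
def IsKMZOutput {V : Type*} [Fintype V] [DecidableEq V] (z : V → V → ℝ) (C : Clustering V) :
    Prop :=
  ∃ L : List (Finset V), RoundingRun z (1 / 5) Finset.univ L ∧ C.parts = L.toFinset

end CorrelationClustering

end

open CorrelationClustering

open Finset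

namespace CorrelationClustering

/-! ### The ℓ₁- and ℓ_∞-norms of nonnegative vectors. -/

section VecNorm

variable {V : Type*} [Fintype V]

/-! Put k = Δ + 1 and e(u,v) = |N_u⁺ \ N_v⁺| (`excess`). By regularity e is symmetric and d = 2e/(k
+ e), so d inherits the semi-metric axioms from e. A positive edge costs at most 2e/k; the negative
edges at u cost at most 1/k per two-edge positive path to a negative neighbour, and there are ∑_{w ∈
N_u⁺} e(u,w) such paths. Hence the fractional cost at u is at most (3/k) ∑_{w ∈ N_u⁺} e(u,w)
(`fracDisagreement_corrMetric_le`).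

For ℓ₁, the sum of these quantities over u counts bad triangles, which are charged to their edges
(`sum_excess_le`); a clustering gives a 0/1 solution of the LP. For ℓ_∞, the quantity is bounded at
each u by the largest disagreement of an arbitrary clustering (`sum_excess_le_of_disagreements_le`).

The rounding loses at most a factor 30 at every vertex separately
(`RoundingRun.card_disagreement_le`), so one output serves both norms. -/

lemma vecNorm_one {y : V → ℝ} (hy : ∀ u, 0 ≤ y u) : vecNorm 1 y = ∑ u, y u := by
  unfold vecNorm
  rw [PiLp.norm_eq_of_L1]
  exact sum_congr rfl fun u _ => by simp [abs_of_nonneg (hy u)]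

lemma vecNorm_top_le {y : V → ℝ} (hy : ∀ u, 0 ≤ y u) {c : ℝ} (hc : 0 ≤ c)
    (hyc : ∀ u, y u ≤ c) : vecNorm ⊤ y ≤ c := by
  unfold vecNorm
  rw [PiLp.norm_toLp]
  exact (pi_norm_le_iff_of_nonneg hc).2 fun u => by simpa [abs_of_nonneg (hy u)] using hyc u

lemma le_vecNorm_top {y : V → ℝ} (u : V) : y u ≤ vecNorm ⊤ y := by
  unfold vecNorm
  rw [PiLp.norm_toLp]
  exact (le_abs_self _).trans (norm_le_pi_norm y u)

lemma vecNorm_nonneg {p : ℝ≥0∞} [Fact (1 ≤ p)] (y : V → ℝ) : 0 ≤ vecNorm p y := norm_nonneg _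

end VecNorm

lemma isBadTriangleFeasible_one {V : Type*} (G : SimpleGraph V) : IsBadTriangleFeasible G fun _ => 1 where
  nonneg _ := zero_le_one
  cover _ _ _ _ _ _ _ := by norm_num

/-! ### Positive neighbourhoods and the correlation metric of a regular graph. -/

section Regular

variable {V : Type*} [Fintype V] [DecidableEq V] (G : SimpleGraph V) [DecidableRel G.Adj]

lemma mem_posNbr {u v : V} : v ∈ posNbr G u ↔ v = u ∨ G.Adj u v := by simp [posNbr]

lemma mem_posNbr_comm {u v : V} : v ∈ posNbr G u ↔ u ∈ posNbr G v := by
  simp only [mem_posNbr, G.adj_comm, eq_comm]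

lemma self_mem_posNbr (u : V) : u ∈ posNbr G u := by simp [posNbr]

lemma mem_negNbr_iff {u v : V} : v ∈ negNbr G u ↔ v ∉ posNbr G u := by
  simp [negNbr, posNbr]

lemma negNbr_eq_compl (u : V) : negNbr G u = (posNbr G u)ᶜ := by
  ext v; simp [mem_negNbr_iff]

variable {G}

lemma card_posNbr {Δ : ℕ} (h : G.IsRegularOfDegree Δ) (u : V) :
    (posNbr G u).card = Δ + 1 := by
  have : posNbr G u = insert u (G.neighborFinset u) := by
    ext v; simp [mem_posNbr]
  rw [this, card_insert_of_notMem (by simp), G.card_neighborFinset_eq_degree, h u]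

variable (G)

/-- The number of positive neighbours of `u` which are not positive neighbours of `v`. -/
def excess (u v : V) : ℝ := ((posNbr G u \ posNbr G v).card : ℝ)

lemma excess_nonneg (u v : V) : 0 ≤ excess G u v := Nat.cast_nonneg _

lemma excess_self (u : V) : excess G u u = 0 := by simp [excess]

lemma excess_triangle (u v w : V) : excess G u v ≤ excess G u w + excess G w v := by
  unfold excess
  have h : posNbr G u \ posNbr G v ⊆
      (posNbr G u \ posNbr G w) ∪ (posNbr G w \ posNbr G v) := by
    intro a; simp only [mem_sdiff, mem_union]; tauto
  exact_mod_cast (card_le_card h).trans (card_union_le _ _)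

variable {G}

section

variable {Δ : ℕ} (h : G.IsRegularOfDegree Δ)
include h

lemma excess_comm (u v : V) : excess G u v = excess G v u := by
  unfold excess
  rw [card_sdiff_comm]
  rw [card_posNbr h, card_posNbr h]

lemma card_inter_posNbr (u v : V) :
    ((posNbr G u ∩ posNbr G v).card : ℝ) = (Δ + 1) - excess G u v := by
  have := card_sdiff_add_card_inter (posNbr G u) (posNbr G v)
  rw [card_posNbr h] at this
  have h2 : ((posNbr G u \ posNbr G v).card : ℝ) + ((posNbr G u ∩ posNbr G v).card : ℝ)
    = Δ + 1 := by exact_mod_cast this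
  unfold excess; linarith

lemma card_union_posNbr (u v : V) :
    ((posNbr G u ∪ posNbr G v).card : ℝ) = (Δ + 1) + excess G u v := by
  have := card_sdiff_add_card (posNbr G u) (posNbr G v)
  rw [card_posNbr h] at this
  have h2 : ((posNbr G u \ posNbr G v).card : ℝ) + (Δ + 1)
    = ((posNbr G u ∪ posNbr G v).card : ℝ) := by exact_mod_cast this
  unfold excess; linarith

lemma excess_le (u v : V) : excess G u v ≤ Δ + 1 := by
  have := card_inter_posNbr h u v
  have h2 : (0 : ℝ) ≤ ((posNbr G u ∩ posNbr G v).card : ℝ) := Nat.cast_nonneg _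
  linarith

/-- Intersection and union have sizes k - e and k + e with k = Δ + 1. Thus d is an increasing
concave function of the pseudometric e, vanishing at 0. -/
lemma corrMetric_eq (u v : V) :
    corrMetric G u v = 2 * excess G u v / ((Δ + 1) + excess G u v) := by
  have := excess_nonneg G u v
  unfold corrMetric
  rw [card_inter_posNbr h, card_union_posNbr h]
  field_simp
  ring

lemma isFeasible_corrMetric : IsFeasible (corrMetric G) where
  self u := by rw [corrMetric_eq h, excess_self]; simp
  symm u v := by rw [corrMetric_eq h, corrMetric_eq h, excess_comm h]
  triangle u v w := by
    rw [corrMetric_eq h, corrMetric_eq h, corrMetric_eq h, excess_comm h v w]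
    have h0 := excess_triangle G u v w
    have h1 := excess_nonneg G u v
    have h2 := excess_nonneg G u w
    have h3 := excess_nonneg G w v
    generalize excess G u v = a at *
    generalize excess G u w = b at *
    generalize excess G w v = c at *
    have hk : (0 : ℝ) < Δ + 1 := by positivity
    generalize (Δ + 1 : ℝ) = k at *
    -- Monotonicity of t ↦ 2t/(k + t), followed by its subadditivity: shrinking the denominators
    -- only increases the fractions.
    calc 2 * a / (k + a) ≤ 2 * (b + c) / (k + (b + c)) := by
          rw [div_le_div_iff₀ (by positivity) (by positivity)]; nlinarith
      _ = 2 * b / (k + (b + c)) + 2 * c / (k + (b + c)) := by ring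
      _ ≤ 2 * b / (k + b) + 2 * c / (k + c) := by
          gcongr <;> linarith
  nonneg u v := by
    rw [corrMetric_eq h]
    have := excess_nonneg G u v
    positivity
  le_one u v := by
    have h1 := excess_nonneg G u v
    have h2 := excess_le h u v
    rw [corrMetric_eq h, div_le_one (by positivity)]
    linarith

lemma corrMetric_le (u v : V) : corrMetric G u v ≤ 2 * excess G u v / (Δ + 1) := by
  have h1 := excess_nonneg G u v
  rw [corrMetric_eq h]
  exact div_le_div_of_nonneg_left (by positivity) (by positivity) (by linarith)

lemma one_sub_corrMetric_le (u v : V) :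
    1 - corrMetric G u v ≤ ((posNbr G u ∩ posNbr G v).card : ℝ) / (Δ + 1) := by
  have h1 := excess_nonneg G u v
  unfold corrMetric
  rw [sub_sub_cancel, card_union_posNbr h]
  exact div_le_div_of_nonneg_left (by positivity) (by positivity) (by linarith)

/-- Paths of two positive edges from `u` to a negative neighbour of `u`, counted by their end and by
their middle vertex. -/
lemma sum_negNbr_card_inter (u : V) :
    ∑ v ∈ negNbr G u, ((posNbr G u ∩ posNbr G v).card : ℝ) =
      ∑ w ∈ posNbr G u, excess G u w := by
  have := sum_card_bipartiteAbove_eq_sum_card_bipartiteBelow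
    (s := negNbr G u) (t := posNbr G u) (fun v w => w ∈ posNbr G v)
  -- For a fixed middle vertex w the possible ends form N_w⁺ \ N_u⁺, the opposite difference from
  -- the one in the statement.
  rw [sum_congr rfl fun w _ => excess_comm h u w]
  unfold excess
  rw [← Nat.cast_sum, ← Nat.cast_sum]
  congr 1
  convert this using 3 with v hv w hw
  · ext a; simp [bipartiteAbove]
  · ext a
    simp only [bipartiteBelow, mem_sdiff, mem_filter, mem_negNbr_iff, mem_posNbr_comm G (v := a)
      (u := w)]
    tauto

lemma fracDisagreement_corrMetric_le (u : V) :
    fracDisagreement G (corrMetric G) u ≤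
      3 / (Δ + 1) * ∑ w ∈ posNbr G u, excess G u w := by
  have h1 : ∑ v ∈ posNbr G u, corrMetric G u v ≤
      2 / (Δ + 1) * ∑ w ∈ posNbr G u, excess G u w := by
    rw [mul_sum]
    refine sum_le_sum fun v _ => (corrMetric_le h u v).trans_eq (by ring)
  have h2 : ∑ v ∈ negNbr G u, (1 - corrMetric G u v) ≤
      1 / (Δ + 1) * ∑ w ∈ posNbr G u, excess G u w := by
    rw [← sum_negNbr_card_inter h, mul_sum]
    refine sum_le_sum fun v _ => (one_sub_corrMetric_le h u v).trans_eq (by ring)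
  calc _ ≤ _ := add_le_add h1 h2
    _ = _ := by ring

end

/-! ### Charging bad triangles to their edges. -/

variable (G)

/-- The indicator of the positive neighbourhoods. -/
def posInd (u v : V) : ℝ := if v ∈ posNbr G u then 1 else 0

lemma posInd_comm (u v : V) : posInd G u v = posInd G v u := by
  simp only [posInd, mem_posNbr_comm G (u := u)]

lemma posInd_nonneg (u v : V) : 0 ≤ posInd G u v := by
  unfold posInd; split_ifs <;> norm_num

lemma posInd_le_one (u v : V) : posInd G u v ≤ 1 := by
  unfold posInd; split_ifs <;> norm_num

lemma excess_eq_sum (u v : V) :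
    excess G u v = ∑ w, posInd G u w * (1 - posInd G v w) := by
  have : posNbr G u \ posNbr G v =
      univ.filter fun w => w ∈ posNbr G u ∧ w ∉ posNbr G v := by
    ext w; simp
  rw [excess, this, card_filter, Nat.cast_sum]
  refine sum_congr rfl fun w _ => ?_
  by_cases h1 : w ∈ posNbr G u <;> by_cases h2 : w ∈ posNbr G v <;> simp [posInd, h1, h2]

lemma sum_posNbr_eq (f : V → ℝ) (u : V) :
    ∑ w ∈ posNbr G u, f w = ∑ w, posInd G u w * f w := by
  simp [posInd, ite_mul, sum_ite_mem]

variable {G}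

lemma sum_posInd {Δ : ℕ} (h : G.IsRegularOfDegree Δ) (u : V) :
    ∑ v, posInd G u v = Δ + 1 := by
  have := sum_posNbr_eq G (fun _ => 1) u
  simp only [sum_const, card_posNbr h, mul_one, nsmul_eq_mul, Nat.cast_add, Nat.cast_one] at this
  exact this.symm

/-- The left side counts triples with w, v ∈ N_u⁺ and v ∉ N_w⁺; each is charged to f on its three
pairs. A positive pair is charged at most Δ + 1 times in each of two roles, a negative pair at most
Δ + 1 times in one. -/
lemma sum_excess_le {Δ : ℕ} (h : G.IsRegularOfDegree Δ) (f : V → V → ℝ)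
    (hf0 : ∀ u v, 0 ≤ f u v)
    (hf : ∀ u v w, w ∈ posNbr G u → v ∈ posNbr G u → v ∉ posNbr G w →
      1 ≤ f u v + f u w + f w v) :
    ∑ u, ∑ w ∈ posNbr G u, excess G u w ≤ 2 * (Δ + 1) * ∑ u, ∑ v, f u v := by
  have a0 := posInd_nonneg G
  have a1 := posInd_le_one G
  have b0 : ∀ u v, 0 ≤ 1 - posInd G u v := fun u v => sub_nonneg.2 (a1 u v)
  have b1 : ∀ u v, 1 - posInd G u v ≤ 1 := fun u v => by linarith [a0 u v]
  -- Each term on the right drops one indicator, so that its third vertex is constrained by a single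
  -- neighbourhood and summing over it gives Δ + 1.
  have hpt : ∀ u w v, posInd G u w * (posInd G u v * (1 - posInd G w v)) ≤
      posInd G u w * (posInd G u v * f u v) + posInd G u v * (posInd G u w * f u w) +
        posInd G w u * ((1 - posInd G w v) * f w v) := by
    intro u w v
    rw [posInd_comm G w u]
    have h1 := hf u v w
    have := hf0 u v
    have := hf0 u w
    have := hf0 w v
    unfold posInd
    by_cases hw : w ∈ posNbr G u <;> by_cases hv : v ∈ posNbr G u <;>
      by_cases hvw : v ∈ posNbr G w <;> simp [hw, hv, hvw] <;>
      first
        | positivity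
        | (have := h1 hw hv hvw; linarith)
  calc ∑ u, ∑ w ∈ posNbr G u, excess G u w
      = ∑ u, ∑ w, ∑ v, posInd G u w * (posInd G u v * (1 - posInd G w v)) := by
        simp only [sum_posNbr_eq, excess_eq_sum, mul_sum]
    _ ≤ ∑ u, ∑ w, ∑ v, (posInd G u w * (posInd G u v * f u v) +
          posInd G u v * (posInd G u w * f u w) +
          posInd G w u * ((1 - posInd G w v) * f w v)) :=
        sum_le_sum fun u _ => sum_le_sum fun w _ => sum_le_sum fun v _ => hpt u w v
    _ = ∑ u, ∑ w, ∑ v, posInd G u w * (posInd G u v * f u v) +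
        ∑ u, ∑ w, ∑ v, posInd G u v * (posInd G u w * f u w) +
        ∑ w, ∑ u, ∑ v, posInd G w u * ((1 - posInd G w v) * f w v) := by
        simp only [sum_add_distrib]
        congr 1
        exact sum_comm
    _ = (Δ + 1) * ∑ u, ∑ v, posInd G u v * f u v + (Δ + 1) * ∑ u, ∑ v, posInd G u v * f u v +
        (Δ + 1) * ∑ u, ∑ v, (1 - posInd G u v) * f u v := by
        simp only [← mul_sum, ← sum_mul, sum_posInd h]
    _ ≤ (Δ + 1) * ∑ u, ∑ v, f u v + (Δ + 1) * ∑ u, ∑ v, f u v := by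
        have e : ∑ u, ∑ v, posInd G u v * f u v + ∑ u, ∑ v, (1 - posInd G u v) * f u v =
            ∑ u, ∑ v, f u v := by
          simp only [← sum_add_distrib]
          exact sum_congr rfl fun u _ => sum_congr rfl fun v _ => by ring
        have e2 : ∑ u, ∑ v, posInd G u v * f u v ≤ ∑ u, ∑ v, f u v :=
          sum_le_sum fun u _ => sum_le_sum fun v _ =>
            mul_le_of_le_one_left (hf0 u v) (a1 u v)
        rw [add_assoc, ← mul_add, e]
        gcongr
    _ = _ := by ring

/-- Every edge of the complete graph has two orientations. -/
lemma sum_offDiag_eq_two_mul_sum_edgeFinset {R : Type*} [NonAssocSemiring R] (x : Sym2 V → R) :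
    ∑ p ∈ (univ : Finset V).offDiag, x s(p.1, p.2) =
      2 * ∑ e ∈ (⊤ : SimpleGraph V).edgeFinset, x e := by
  have hmaps : ∀ p ∈ (univ : Finset V).offDiag,
      s(p.1, p.2) ∈ (⊤ : SimpleGraph V).edgeFinset := by
    rintro ⟨a, b⟩ hp; simpa using hp
  rw [← sum_fiberwise_of_maps_to hmaps, mul_sum]
  refine sum_congr rfl fun e he => ?_
  induction e with
  | h a b =>
    have hab : a ≠ b := by simpa using he
    have : ((univ : Finset V).offDiag.filter fun p => s(p.1, p.2) = s(a, b)) =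
        {(a, b), (b, a)} := by
      ext ⟨c, d⟩
      simp only [mem_filter, mem_offDiag, mem_univ, true_and, Sym2.eq_iff, mem_insert,
        mem_singleton, Prod.mk.injEq]
      constructor
      · exact fun h => h.2
      · rintro (⟨rfl, rfl⟩ | ⟨rfl, rfl⟩)
        · exact ⟨hab, by simp⟩
        · exact ⟨hab.symm, by simp⟩
    rw [this, sum_pair (by simp [hab]), Sym2.eq_swap (a := b), two_mul]

lemma sum_ite_eq_two_mul_sum_edgeFinset (x : Sym2 V → ℝ) :
    ∑ u, ∑ v, (if u = v then 0 else x s(u, v)) =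
      2 * ∑ e ∈ (⊤ : SimpleGraph V).edgeFinset, x e := by
  rw [← sum_offDiag_eq_two_mul_sum_edgeFinset, ← sum_product' univ univ
    (fun u v => if u = v then 0 else x s(u, v))]
  have : (univ : Finset V).offDiag = (univ ×ˢ univ).filter fun p => ¬ p.1 = p.2 := by
    ext; simp
  rw [this, sum_filter]
  exact sum_congr rfl fun p _ => by rw [ite_not]

lemma fracDisagreement_nonneg {x : V → V → ℝ} (hx : IsFeasible x) (u : V) :
    0 ≤ fracDisagreement G x u :=
  add_nonneg (sum_nonneg fun v _ => hx.nonneg u v)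
    (sum_nonneg fun v _ => sub_nonneg.2 (hx.le_one u v))

lemma fracCost_one {x : V → V → ℝ} (hx : IsFeasible x) :
    fracCost G 1 x = ∑ u, fracDisagreement G x u :=
  vecNorm_one fun u => fracDisagreement_nonneg hx u

lemma cost_one (C : Clustering V) : cost G 1 C = ∑ u, (disagreements G C u : ℝ) :=
  vecNorm_one fun _ => Nat.cast_nonneg _

lemma fracCost_corrMetric_le_of_badTriangle {Δ : ℕ} (h : G.IsRegularOfDegree Δ)
    {x : Sym2 V → ℝ} (hx : IsBadTriangleFeasible G x) :
    fracCost G 1 (corrMetric G) ≤ 12 * ∑ e ∈ (⊤ : SimpleGraph V).edgeFinset, x e := by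
  rw [fracCost_one (isFeasible_corrMetric h)]
  -- Loops get weight 0 because the LP objective omits them; the vertices of a bad triangle are
  -- distinct, so the covering condition survives.
  have key := sum_excess_le h (fun u v => if u = v then 0 else x s(u, v))
    (fun u v => by split_ifs; exacts [le_rfl, hx.nonneg _])
    (fun u v w hw hv hvw => by
      have hvw' := hvw
      simp only [mem_posNbr, not_or] at hw hv hvw'
      have huw : u ≠ w := by rintro rfl; exact hvw ((mem_posNbr G).2 hv)
      have huv : u ≠ v := by
        rintro rfl; exact hvw ((mem_posNbr_comm G).1 ((mem_posNbr G).2 hw))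
      have := hx.cover v u w ((hv.resolve_left huv.symm).symm) (hw.resolve_left huw.symm)
        (Ne.symm hvw'.1) hvw'.2
      rw [if_neg huv, if_neg huw, if_neg (Ne.symm hvw'.1), Sym2.eq_swap (a := u) (b := v)]
      exact this)
  rw [sum_ite_eq_two_mul_sum_edgeFinset] at key
  calc ∑ u, fracDisagreement G (corrMetric G) u
      ≤ ∑ u, 3 / (Δ + 1 : ℝ) * ∑ w ∈ posNbr G u, excess G u w :=
        sum_le_sum fun u _ => fracDisagreement_corrMetric_le h u
    _ = 3 / (Δ + 1 : ℝ) * ∑ u, ∑ w ∈ posNbr G u, excess G u w := by rw [mul_sum]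
    _ ≤ 3 / (Δ + 1 : ℝ) *
        (2 * (Δ + 1) * (2 * ∑ e ∈ (⊤ : SimpleGraph V).edgeFinset, x e)) := by gcongr
    -- 12 = 3 · 2 · 2, the last factor for the two orientations of an edge.
    _ = _ := by field_simp; ring

lemma fracCost_corrMetric_le_badTriangleOpt {Δ : ℕ} (h : G.IsRegularOfDegree Δ) :
    fracCost G 1 (corrMetric G) ≤ 6 * (2 * badTriangleOpt G) := by
  have : fracCost G 1 (corrMetric G) / 12 ≤ badTriangleOpt G := by
    refine le_csInf ⟨_, _, isBadTriangleFeasible_one G, rfl⟩ ?_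
    rintro _ ⟨x, hx, rfl⟩
    have := fracCost_corrMetric_le_of_badTriangle h hx
    dsimp only
    linarith
  linarith

/-! ### Comparison with an arbitrary clustering. -/

section Clustering

variable (G) (C : Clustering V)

/-- The pair `u`, `v` is a disagreement of `C`. -/
def IsDisagreement (u v : V) : Prop :=
  (v ∈ posNbr G u ∧ v ∉ C.part u) ∨ (v ∉ posNbr G u ∧ v ∈ C.part u)

lemma mem_part_comm {u v : V} : v ∈ C.part u ↔ u ∈ C.part v := by
  rw [C.mem_part_iff_part_eq_part (mem_univ _) (mem_univ _),
    C.mem_part_iff_part_eq_part (mem_univ _) (mem_univ _), eq_comm]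

lemma isDisagreement_comm {u v : V} : IsDisagreement G C u v ↔ IsDisagreement G C v u := by
  unfold IsDisagreement
  rw [mem_posNbr_comm, mem_part_comm]

lemma not_isDisagreement_self (u : V) : ¬ IsDisagreement G C u u := by
  simp [IsDisagreement, self_mem_posNbr]

open Classical in
lemma disagreements_eq (u : V) :
    disagreements G C u = (univ.filter (IsDisagreement G C u)).card := by
  unfold disagreements
  rw [← card_union_of_disjoint]
  · congr 1
    ext v
    simp [IsDisagreement, mem_negNbr_iff]
  · rw [disjoint_left]
    intro v
    simp only [mem_filter]
    tauto

open Classical in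
/-- The `0`/`1`-solution of the bad-triangle relaxation that belongs to a clustering. -/
noncomputable def disagreementInd (e : Sym2 V) : ℝ :=
  Sym2.lift ⟨fun u v => if IsDisagreement G C u v then (1 : ℝ) else 0,
    fun _ _ => by simp only [isDisagreement_comm]⟩ e

open Classical in
lemma disagreementInd_mk (u v : V) :
    disagreementInd G C s(u, v) = if IsDisagreement G C u v then (1 : ℝ) else 0 := rfl

/-- If both positive edges of a bad triangle agree with `C`, its vertices share a cluster, and then
the negative edge disagrees. -/
lemma isBadTriangleFeasible_disagreementInd :
    IsBadTriangleFeasible G (disagreementInd G C) where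
  nonneg e := by
    induction e with
    | h u v => rw [disagreementInd_mk]; split_ifs <;> norm_num
  cover i j k hij hjk hki hnki := by
    have h0 : ∀ u v, 0 ≤ disagreementInd G C s(u, v) := fun u v => by
      rw [disagreementInd_mk]; split_ifs <;> norm_num
    have : IsDisagreement G C i j ∨ IsDisagreement G C j k ∨ IsDisagreement G C k i := by
      by_contra! hcon
      obtain ⟨h1, h2, h3⟩ := hcon
      simp only [IsDisagreement, mem_posNbr,
        C.mem_part_iff_part_eq_part (mem_univ _) (mem_univ _)] at h1 h2 h3
      have e1 : C.part j = C.part i := by tauto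
      have e2 : C.part k = C.part j := by tauto
      have : C.part i = C.part k := (e2.trans e1).symm
      have := hki.symm
      tauto
    have h1 := h0 i j
    have h2 := h0 j k
    have h3 := h0 k i
    rcases this with h | h | h
    · rw [disagreementInd_mk, if_pos h]; linarith
    · rw [disagreementInd_mk G C j k, if_pos h]; linarith
    · rw [disagreementInd_mk G C k i, if_pos h]; linarith

lemma two_mul_sum_disagreementInd :
    2 * ∑ e ∈ (⊤ : SimpleGraph V).edgeFinset, disagreementInd G C e = cost G 1 C := by
  classical
  rw [← sum_ite_eq_two_mul_sum_edgeFinset, cost_one]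
  refine sum_congr rfl fun u _ => ?_
  rw [disagreements_eq, card_filter, Nat.cast_sum]
  refine sum_congr rfl fun v _ => ?_
  split_ifs with huv hd
  · subst huv; exact absurd hd (not_isDisagreement_self G C u)
  · simp
  · simp [disagreementInd_mk, *]
  · simp [disagreementInd_mk, *]

variable {G C}

/-- Positive neighbours w in the cluster of u contribute at most 2D each; at most D of them lie
outside, contributing at most Δ + 1 each. -/
lemma sum_excess_le_of_disagreements_le {Δ : ℕ} (h : G.IsRegularOfDegree Δ) {D : ℝ}
    (hD : ∀ u, (disagreements G C u : ℝ) ≤ D) (u : V) :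
    ∑ w ∈ posNbr G u, excess G u w ≤ 3 * (Δ + 1) * D := by
  have hsame : ∀ w, w ∈ C.part u → excess G u w ≤ 2 * D := by
    intro w hw
    -- A vertex of N_u⁺ \ N_w⁺ disagrees with u if it lies outside the common cluster, and with w if
    -- it lies inside.
    have hsub : posNbr G u \ posNbr G w ⊆
        ((posNbr G u).filter fun v => v ∉ C.part u) ∪
          ((negNbr G w).filter fun v => v ∈ C.part w) := by
      intro v
      have e : C.part w = C.part u :=
        (C.mem_part_iff_part_eq_part (mem_univ _) (mem_univ _)).1 hw |>.symm ▸ rfl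
      simp only [mem_sdiff, mem_union, mem_filter, mem_negNbr_iff, e]
      tauto
    have h1 : (posNbr G u \ posNbr G w).card ≤ disagreements G C u + disagreements G C w := by
      refine (card_le_card hsub).trans ((card_union_le _ _).trans ?_)
      unfold disagreements
      omega
    have h2 : excess G u w ≤ disagreements G C u + disagreements G C w := by
      unfold excess; exact_mod_cast h1
    linarith [hD u, hD w]
  have hk : (0 : ℝ) < Δ + 1 := by positivity
  have hD0 : 0 ≤ D := (Nat.cast_nonneg _).trans (hD u)
  have hother : ((((posNbr G u).filter fun v => v ∉ C.part u).card : ℕ) : ℝ) ≤ D := by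
    refine le_trans ?_ (hD u)
    unfold disagreements
    push_cast
    linarith [Nat.cast_nonneg (α := ℝ) ((negNbr G u).filter fun v => v ∈ C.part u).card]
  rw [← sum_filter_add_sum_filter_not _ (fun v => v ∈ C.part u)]
  have h1 : ∑ w ∈ (posNbr G u).filter (fun v => v ∈ C.part u), excess G u w ≤
      (Δ + 1) * (2 * D) := by
    refine (sum_le_card_nsmul _ _ (2 * D) fun w hw => hsame w (mem_filter.1 hw).2).trans ?_
    rw [nsmul_eq_mul]
    gcongr
    have := card_filter_le (posNbr G u) (fun v => v ∈ C.part u)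
    rw [card_posNbr h] at this
    exact_mod_cast this
  have h2 : ∑ w ∈ (posNbr G u).filter (fun v => v ∉ C.part u), excess G u w ≤
      D * (Δ + 1) := by
    refine (sum_le_card_nsmul _ _ (Δ + 1 : ℝ) fun w _ => excess_le h u w).trans ?_
    rw [nsmul_eq_mul]
    gcongr
  linarith

lemma fracDisagreement_corrMetric_le_cost_top {Δ : ℕ} (h : G.IsRegularOfDegree Δ) (u : V) :
    fracDisagreement G (corrMetric G) u ≤ 9 * cost G ⊤ C := by
  have h1 := sum_excess_le_of_disagreements_le (C := C) h (D := cost G ⊤ C)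
    (fun u => le_vecNorm_top (y := fun u => (disagreements G C u : ℝ)) u) u
  calc _ ≤ _ := fracDisagreement_corrMetric_le h u
    _ ≤ 3 / (Δ + 1 : ℝ) * (3 * (Δ + 1) * cost G ⊤ C) := by gcongr
    _ = _ := by field_simp; ring

lemma fracCost_corrMetric_le_cost_one {Δ : ℕ} (h : G.IsRegularOfDegree Δ) (C : Clustering V) :
    fracCost G 1 (corrMetric G) ≤ 6 * cost G 1 C := by
  rw [← two_mul_sum_disagreementInd]
  have := fracCost_corrMetric_le_of_badTriangle h (isBadTriangleFeasible_disagreementInd G C)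
  linarith

lemma le_mul_opt {p : ℝ≥0∞} {a c : ℝ} (hc : 0 < c) (h : ∀ C : Clustering V, a ≤ c * cost G p C) :
    a ≤ c * opt G p := by
  have : a / c ≤ opt G p := le_ciInf fun C => by
    rw [div_le_iff₀' hc]; exact h C
  rwa [div_le_iff₀' hc] at this

end Clustering

end Regular

/-! ### The rounding algorithm and its vertexwise analysis. -/

section Rounding

variable {V : Type*} [DecidableEq V] {z : V → V → ℝ}

lemma RoundingRun.exists_run {r : ℝ} (hr : 0 ≤ r) (hz : ∀ u, z u u = 0) (S : Finset V) :
    ∃ L, RoundingRun z r S L := by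
  induction S using Finset.strongInduction with
  | H S ih =>
    rcases S.eq_empty_or_nonempty with rfl | hS
    · exact ⟨[], .done⟩
    · obtain ⟨u, hu, hmax⟩ := S.exists_max_image (centerScore z r S) hS
      have huB : u ∈ ballIn z S u (2 * r) := by
        simp only [ballIn, mem_filter, hz]; exact ⟨hu, by positivity⟩
      obtain ⟨L, hL⟩ := ih (S \ ballIn z S u (2 * r))
        (sdiff_ssubset (filter_subset _ _) ⟨u, huB⟩)
      exact ⟨_, .step S u L hu hmax hL⟩

lemma RoundingRun.mem_iff {r : ℝ} {S : Finset V} {L : List (Finset V)}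
    (h : RoundingRun z r S L) {v : V} : v ∈ S ↔ ∃ c ∈ L, v ∈ c := by
  induction h with
  | done => simp
  | step S u L hu hmax hrun ih =>
    have hsub : ballIn z S u (2 * r) ⊆ S := filter_subset _ _
    simp only [List.mem_cons, exists_eq_or_imp, ← ih, mem_sdiff]
    have := @hsub v
    tauto

lemma RoundingRun.nonempty {r : ℝ} (hr : 0 ≤ r) (hz : ∀ u, z u u = 0) {S : Finset V}
    {L : List (Finset V)} (h : RoundingRun z r S L) : ∀ c ∈ L, c.Nonempty := by
  induction h with
  | done => simp
  | step S u L hu hmax hrun ih =>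
    simp only [List.mem_cons, forall_eq_or_imp]
    refine ⟨⟨u, ?_⟩, ih⟩
    simp only [ballIn, mem_filter, hz]; exact ⟨hu, by positivity⟩

lemma RoundingRun.eq_of_mem {r : ℝ} {S : Finset V} {L : List (Finset V)}
    (h : RoundingRun z r S L) :
    ∀ c ∈ L, ∀ c' ∈ L, ∀ v, v ∈ c → v ∈ c' → c = c' := by
  induction h with
  | done => simp
  | step S u L hu hmax hrun ih =>
    have key : ∀ c ∈ L, ∀ v ∈ c, v ∉ ballIn z S u (2 * r) := fun c hc v hv =>
      (mem_sdiff.1 (hrun.mem_iff.2 ⟨c, hc, hv⟩)).2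
    intro c hc c' hc' v hv hv'
    rcases List.mem_cons.1 hc with rfl | hc <;> rcases List.mem_cons.1 hc' with rfl | hc'
    · rfl
    · exact absurd hv (key _ hc' _ hv')
    · exact absurd hv' (key _ hc _ hv)
    · exact ih c hc c' hc' v hv hv'

lemma exists_isKMZOutput [Fintype V] (hz : ∀ u, z u u = 0) :
    ∃ C : Clustering V, IsKMZOutput z C := by
  obtain ⟨L, hL⟩ := RoundingRun.exists_run (r := 1 / 5) (by norm_num) hz univ
  refine ⟨⟨L.toFinset, ?_, ?_, ?_⟩, L, hL, rfl⟩
  · rw [supIndep_iff_pairwiseDisjoint]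
    intro c hc c' hc' hne
    simp only [List.coe_toFinset, Set.mem_ofPred_eq] at hc hc'
    exact disjoint_left.2 fun v hv hv' => hne (hL.eq_of_mem c hc c' hc' v hv hv')
  · ext v
    simpa [mem_sup] using hL.mem_iff (v := v)
  · intro hbot
    exact (hL.nonempty (by norm_num) hz _ (List.mem_toFinset.1 hbot)).ne_empty rfl

/-- The disagreement of `u` with the run `L` at `v`, for the set `P` of positive neighbours. -/
def RunDisagreement (P : Finset V) (L : List (Finset V)) (u v : V) : Prop :=
  (v ∈ P ∧ ¬ ∃ c ∈ L, u ∈ c ∧ v ∈ c) ∨ (v ∉ P ∧ ∃ c ∈ L, u ∈ c ∧ v ∈ c)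

/-- The fractional cost of the pair `u`, `v`, for the set `P` of positive neighbours of `u`. -/
def pairCost (z : V → V → ℝ) (P : Finset V) (u v : V) : ℝ :=
  if v ∈ P then z u v else 1 - z u v

lemma pairCost_nonneg (hz : IsFeasible z) (P : Finset V) (u v : V) : 0 ≤ pairCost z P u v := by
  unfold pairCost
  split_ifs
  exacts [hz.nonneg u v, sub_nonneg.2 (hz.le_one u v)]

/-- If a cluster with centre `w` is cut out of `S`, then the short edges from `u ∈ S` that are cut
are paid for by the pairs of `u` and the members of the cluster. -/
lemma card_short_cut_le (hz : IsFeasible z) (P : Finset V) {S : Finset V} {u w : V} (hu : u ∈ S)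
    (hmax : centerScore z (1 / 5) S u ≤ centerScore z (1 / 5) S w) {T : Finset V} (hTS : T ⊆ S)
    (hshort : ∀ v ∈ T, z u v ≤ 1 / 10)
    (hcut : ∀ v ∈ T, ¬ (u ∈ ballIn z S w (2 * (1 / 5)) ↔ v ∈ ballIn z S w (2 * (1 / 5)))) :
    (T.card : ℝ) ≤ 20 * ∑ v ∈ ballIn z S w (2 * (1 / 5)), pairCost z P u v := by
  have hF := pairCost_nonneg hz P u
  rcases T.eq_empty_or_nonempty with rfl | ⟨t, ht⟩
  · simp only [card_empty, Nat.cast_zero]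
    exact mul_nonneg (by norm_num) (sum_nonneg fun v _ => hF v)
  -- A cut edge of length at most 1/10 puts u within 1/10 of the cluster radius 2/5.
  have hw : 3 / 10 ≤ z w u ∧ z w u ≤ 1 / 2 := by
    have h1 := hcut t ht
    have h2 := hshort t ht
    have h3 := hz.triangle w t u
    have h4 := hz.triangle w u t
    rw [hz.symm t u] at h3
    simp only [ballIn, mem_filter, hu, hTS ht, true_and] at h1
    by_cases h5 : z w u ≤ 2 * (1 / 5)
    · have : ¬ z w t ≤ 2 * (1 / 5) := by tauto
      constructor <;> linarith
    · have : z w t ≤ 2 * (1 / 5) := by tauto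
      constructor <;> linarith
  -- Every short cut edge adds at least 1/10 to the score of u, hence to that of the maximizer w.
  have hlow : (T.card : ℝ) * (1 / 10) ≤ centerScore z (1 / 5) S u := by
    have hsub : T ⊆ ballIn z S u (1 / 5) := fun v hv =>
      mem_filter.2 ⟨hTS hv, (hshort v hv).trans (by norm_num)⟩
    calc (T.card : ℝ) * (1 / 10) = ∑ v ∈ T, (1 / 10 : ℝ) := by simp
      _ ≤ ∑ v ∈ T, (1 / 5 - z u v) := sum_le_sum fun v hv => by linarith [hshort v hv]
      _ ≤ _ := sum_le_sum_of_subset_of_nonneg hsub fun v hv _ =>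
        sub_nonneg.2 (mem_filter.1 hv).2
  -- For t = z w v ≤ 1/5, the pair u, v costs at least 3/10 - t or 1/2 - t, according to its sign;
  -- either is at least (1/5 - t)/2.
  have hup : centerScore z (1 / 5) S w ≤
      2 * ∑ v ∈ ballIn z S w (2 * (1 / 5)), pairCost z P u v := by
    have hsub : ballIn z S w (1 / 5) ⊆ ballIn z S w (2 * (1 / 5)) := fun v hv => by
      simp only [ballIn, mem_filter] at hv ⊢
      exact ⟨hv.1, by linarith [hv.2]⟩
    calc centerScore z (1 / 5) S w ≤ ∑ v ∈ ballIn z S w (1 / 5), 2 * pairCost z P u v := by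
          refine sum_le_sum fun v hv => ?_
          have h1 := (mem_filter.1 hv).2
          have h2 := hz.triangle w u v
          have h3 := hz.triangle u v w
          rw [hz.symm u w, hz.symm v w] at h3
          have h4 := hz.nonneg w v
          unfold pairCost
          split_ifs <;> linarith
      _ ≤ ∑ v ∈ ballIn z S w (2 * (1 / 5)), 2 * pairCost z P u v :=
          sum_le_sum_of_subset_of_nonneg hsub fun v _ _ => mul_nonneg zero_le_two (hF v)
      _ = _ := by rw [mul_sum]
  linarith

lemma card_le_ten_mul_sum (P : Finset V) {u : V} {A : Finset V}
    (h : ∀ v ∈ A, 1 / 10 ≤ pairCost z P u v) :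
    (A.card : ℝ) ≤ 10 * ∑ v ∈ A, pairCost z P u v := by
  have := card_nsmul_le_sum A (pairCost z P u) (1 / 10) h
  rw [nsmul_eq_mul] at this
  linarith

open Classical in
/-- If every `v ∈ A` has pair cost at least `1 / 10` or is a positive neighbour cut from `u` by the
cluster of `w`, then the pair costs of `A` and of this cluster pay for `A`. -/
lemma card_runDisagreement_step (hz : IsFeasible z) (P : Finset V) {S : Finset V} {u w : V}
    (hu : u ∈ S) (hmax : centerScore z (1 / 5) S u ≤ centerScore z (1 / 5) S w)
    {A : Finset V} (hAS : A ⊆ S)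
    (hA : ∀ v ∈ A, 1 / 10 ≤ pairCost z P u v ∨ v ∈ P ∧
      ¬ (u ∈ ballIn z S w (2 * (1 / 5)) ↔ v ∈ ballIn z S w (2 * (1 / 5)))) :
    (A.card : ℝ) ≤ 10 * ∑ v ∈ A, pairCost z P u v +
      20 * ∑ v ∈ ballIn z S w (2 * (1 / 5)), pairCost z P u v := by
  rw [← card_filter_add_card_filter_not (s := A)
    (p := fun v => 1 / 10 ≤ pairCost z P u v), Nat.cast_add]
  refine add_le_add ?_ ?_
  · refine (card_le_ten_mul_sum P fun v hv => (mem_filter.1 hv).2).trans ?_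
    gcongr
    · exact fun v _ _ => pairCost_nonneg hz P u v
    · exact filter_subset _ _
  · have hB : ∀ v ∈ A.filter (fun v => ¬ 1 / 10 ≤ pairCost z P u v), v ∈ P ∧
        ¬ (u ∈ ballIn z S w (2 * (1 / 5)) ↔ v ∈ ballIn z S w (2 * (1 / 5))) := fun v hv =>
      (hA v (mem_filter.1 hv).1).resolve_left (mem_filter.1 hv).2
    refine card_short_cut_le hz P hu hmax ((filter_subset _ _).trans hAS) ?_ fun v hv =>
      (hB v hv).2
    intro v hv
    have h1 := (mem_filter.1 hv).2
    rw [pairCost, if_pos (hB v hv).1] at h1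
    exact (not_le.1 h1).le

-- Induction on the run. A cluster cut before u is clustered decides the pairs of u with its
-- members, and their costs pay 10 + 20 times for the disagreements among them. When u itself is
-- clustered, all remaining pairs are decided, and their total cost pays in the same way.
open Classical in
lemma RoundingRun.card_disagreement_le (hz : IsFeasible z) (P : Finset V) {S : Finset V}
    {L : List (Finset V)} (h : RoundingRun z (1 / 5) S L) {u : V} (hu : u ∈ S) :
    ((S.filter (RunDisagreement P L u)).card : ℝ) ≤ 30 * ∑ v ∈ S, pairCost z P u v := by
  induction h with
  | done => simp at hu
  | step S w L hw hmax hrun ih =>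
    have hF := pairCost_nonneg hz P u
    set B := ballIn z S w (2 * (1 / 5)) with hBdef
    have hBS : B ⊆ S := filter_subset _ _
    have hsplit : ∑ v ∈ S, pairCost z P u v =
        ∑ v ∈ S \ B, pairCost z P u v + ∑ v ∈ B, pairCost z P u v :=
      (sum_sdiff hBS).symm
    have hSB : 0 ≤ ∑ v ∈ S \ B, pairCost z P u v := sum_nonneg fun v _ => hF v
    have hL : ∀ v, v ∈ B → ¬ ∃ c ∈ L, v ∈ c := fun v hv hc =>
      (mem_sdiff.1 (hrun.mem_iff.2 hc)).2 hv
    by_cases huB : u ∈ B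
    · have hiff : ∀ v, (∃ c ∈ B :: L, u ∈ c ∧ v ∈ c) ↔ v ∈ B := by
        intro v
        simp only [List.mem_cons, exists_eq_or_imp, huB, true_and]
        refine or_iff_left ?_
        rintro ⟨c, hc, huc, -⟩
        exact hL u huB ⟨c, hc, huc⟩
      have := card_runDisagreement_step hz P hu (hmax u hu)
        (A := S.filter (RunDisagreement P (B :: L) u)) (filter_subset _ _) (by
          intro v hv
          have hv2 := (mem_filter.1 hv).2
          unfold RunDisagreement at hv2
          rw [hiff] at hv2
          rcases hv2 with ⟨hP, hvB⟩ | ⟨hP, hvB⟩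
          · right
            refine ⟨hP, ?_⟩
            rw [← hBdef]
            tauto
          · left
            -- Both u and v lie within 2/5 of the centre, so z u v ≤ 4/5 and the negative pair costs
            -- at least 1/5.
            have h1 := (mem_filter.1 hvB).2
            have h2 := (mem_filter.1 huB).2
            have h3 := hz.triangle u v w
            rw [hz.symm u w, hz.symm v w] at h3
            rw [pairCost, if_neg hP]
            linarith)
      have h2 : ∑ v ∈ S.filter (RunDisagreement P (B :: L) u), pairCost z P u v ≤
          ∑ v ∈ S, pairCost z P u v :=
        sum_le_sum_of_subset_of_nonneg (filter_subset _ _) fun v _ _ => hF v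
      rw [← hBdef] at this
      linarith
    · have hiff : ∀ v, (∃ c ∈ B :: L, u ∈ c ∧ v ∈ c) ↔ ∃ c ∈ L, u ∈ c ∧ v ∈ c := by
        intro v
        simp [huB]
      have heq : ∀ v, RunDisagreement P (B :: L) u v ↔ RunDisagreement P L u v := by
        intro v
        unfold RunDisagreement
        rw [hiff]
      have ih' := ih (mem_sdiff.2 ⟨hu, huB⟩)
      have hstep := card_runDisagreement_step hz P hu (hmax u hu)
        (A := B.filter (RunDisagreement P (B :: L) u)) ((filter_subset _ _).trans hBS) (by
          intro v hv
          have hv1 := (mem_filter.1 hv).1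
          have hv2 := (mem_filter.1 hv).2
          right
          unfold RunDisagreement at hv2
          rw [hiff] at hv2
          -- Members of B occur in no later cluster, so they never join u; only positive pairs can
          -- disagree.
          have hno : ¬ ∃ c ∈ L, u ∈ c ∧ v ∈ c := by
            rintro ⟨c, hc, -, hvc⟩
            exact hL v hv1 ⟨c, hc, hvc⟩
          refine ⟨hv2.elim And.left fun h => absurd h.2 hno, ?_⟩
          rw [← hBdef]
          tauto)
      have h2 : ∑ v ∈ B.filter (RunDisagreement P (B :: L) u), pairCost z P u v ≤
          ∑ v ∈ B, pairCost z P u v :=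
        sum_le_sum_of_subset_of_nonneg (filter_subset _ _) fun v _ _ => hF v
      have hcard : (S.filter (RunDisagreement P (B :: L) u)).card ≤
          ((S \ B).filter (RunDisagreement P L u)).card +
            (B.filter (RunDisagreement P (B :: L) u)).card := by
        refine le_trans (card_le_card ?_) (card_union_le _ _)
        intro v
        simp only [mem_filter, mem_union, mem_sdiff, heq]
        tauto
      have hcard' : ((S.filter (RunDisagreement P (B :: L) u)).card : ℝ) ≤
          ((S \ B).filter (RunDisagreement P L u)).card +
            (B.filter (RunDisagreement P (B :: L) u)).card := by exact_mod_cast hcard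
      rw [← hBdef] at hstep
      linarith

variable [Fintype V] {G : SimpleGraph V} [DecidableRel G.Adj]

lemma sum_pairCost_eq (u : V) :
    ∑ v, pairCost z (posNbr G u) u v = fracDisagreement G z u := by
  unfold fracDisagreement pairCost
  rw [sum_ite, negNbr_eq_compl]
  congr 1
  · simp
  · congr 1; ext v; simp

lemma disagreements_le_of_isKMZOutput (hz : IsFeasible z) {C : Clustering V}
    (hC : IsKMZOutput z C) (u : V) :
    (disagreements G C u : ℝ) ≤ 30 * fracDisagreement G z u := by
  classical
  obtain ⟨L, hL, hparts⟩ := hC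
  have := hL.card_disagreement_le hz (posNbr G u) (mem_univ u)
  rw [sum_pairCost_eq] at this
  rw [disagreements_eq]
  convert this using 4 with v
  have : v ∈ C.part u ↔ ∃ c ∈ L, u ∈ c ∧ v ∈ c := by
    rw [Finpartition.mem_part_iff_exists]
    simp [hparts, and_comm]
  simp only [IsDisagreement, RunDisagreement, this]

end Rounding

end CorrelationClustering

open CorrelationClustering
theorem theorem3 :
    (∀ (V : Type*) [Fintype V] [DecidableEq V] (G : SimpleGraph V) [DecidableRel G.Adj] (Δ : ℕ),
      G.IsRegularOfDegree Δ →
        IsFeasible (corrMetric G) ∧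
        fracCost G 1 (corrMetric G) =
          ∑ u : V, ∑ v ∈ posNbr G u,
              corrMetric G u v +
            ∑ u : V, ∑ v ∈ negNbr G u,
              (1 - corrMetric G u v) ∧
        fracCost G 1 (corrMetric G) ≤
          6 * opt G 1 ∧
        fracCost G 1 (corrMetric G) ≤
          6 * (2 * badTriangleOpt G)) ∧
    ∃ K : ℝ,
      ∀ (V : Type*) [Fintype V] [DecidableEq V] (G : SimpleGraph V) [DecidableRel G.Adj] (Δ : ℕ),
        G.IsRegularOfDegree Δ →
          (∃ C : Clustering V,
            IsKMZOutput (corrMetric G) C) ∧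
          ∀ C : Clustering V,
            IsKMZOutput (corrMetric G) C →
              cost G 1 C ≤ K * opt G 1 ∧
              cost G ⊤ C ≤ K * opt G ⊤ := by
  -- 270 = 30 · 9 comes from the ℓ_∞ bound; for ℓ₁ already 30 · 6 suffices.
  refine ⟨fun V _ _ G _ Δ h => ?_, 270, fun V _ _ G _ Δ h => ?_⟩
  · have hf := isFeasible_corrMetric h
    refine ⟨hf, ?_, le_mul_opt (by norm_num) fun C => fracCost_corrMetric_le_cost_one h C,
      fracCost_corrMetric_le_badTriangleOpt h⟩
    rw [fracCost_one hf, ← Finset.sum_add_distrib]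
    rfl
  · have hf := isFeasible_corrMetric h
    refine ⟨exists_isKMZOutput hf.self, fun C hC => ?_⟩
    have hu := disagreements_le_of_isKMZOutput (G := G) hf hC
    constructor
    · refine le_mul_opt (by norm_num) fun C' => ?_
      have h1 := fracCost_corrMetric_le_cost_one h C'
      have h2 : cost G 1 C ≤ 30 * fracCost G 1 (corrMetric G) := by
        rw [cost_one, fracCost_one hf, Finset.mul_sum]
        exact Finset.sum_le_sum fun u _ => hu u
      have h3 : 0 ≤ cost G 1 C' := vecNorm_nonneg _
      linarith
    · refine le_mul_opt (by norm_num) fun C' => ?_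
      have h3 : 0 ≤ cost G ⊤ C' := vecNorm_nonneg _
      refine vecNorm_top_le (fun _ => Nat.cast_nonneg _) (by linarith) fun u => ?_
      have h1 := fracDisagreement_corrMetric_le_cost_top (C := C') h u
      linarith [hu u]
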